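/- Let $c=\{c_k\}_{k\in\mathbb Z}$ be a sequence of complex numbers with $\lim_{|k|\to\infty}c_k=0$ and $\sum_{k=-\infty}^{\infty}|c_k-c_{k+1}|<\infty$ (that is, $c$ is a null-sequence of bounded variation, $c\in bv$). For a sequence $a=\{a_k\}_{k\in\mathbb Z}$, its discrete Hilbert transform $ha=\{ha_n\}_{n\in\mathbb Z}$ is $$ha_n=\sum_{k=-\infty}^{\infty}\frac{a_k}{n+\frac12-k}=\lim_{N\to\infty}\sum_{k=-N}^{N}\frac{a_k}{n+\frac12-k},$$ and it is said to exist if this limit exists for every $n\in\mathbb Z$ (as it does, absolutely, when $a$ is summable). Suppose that at least one of the following two conditions holds: 1) the discrete Hilbert transform of the sequence of differences $d=\{d_k\}$, $d_k=c_{k+1}-c_k$, is summable: $\sum_{n=-\infty}^{\infty}|hd_n|<\infty$; 2) the discrete Hilbert transform $hc$ exists and is of bounded variation: $\sum_{n=-\infty}^{\infty}|hc_n-hc_{n+1}|<\infty$. Then the series $\sum_{k=-\infty}^{\infty}c_ke^{ikt}$ is a Fourier series, that is, there is an integrable, $2\pi$-periodic function $f\in L_1([-\pi,\pi))$ such that $c_k=\frac1{2\pi}\int_{-\pi}^{\pi}f(t)e^{-ikt}\,dt$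 for all $k\in\mathbb Z$. -/

import Mathlib

open Filter Topology

/-- A two-sided sequence is a null-sequence if `c k → 0` as `|k| → ∞`. -/
def IsNullSeq (c : ℤ → ℂ) : Prop :=
  Tendsto c cofinite (𝓝 0)

/-- `c ∈ bv`: the differences of consecutive terms are absolutely summable. -/
def IsBV (c : ℤ → ℂ) : Prop :=
  Summable fun k : ℤ => ‖c k - c (k + 1)‖

/-- The discrete Hilbert transform of `c` exists and equals `h`: for every integer `n` the series
`∑_{k=-∞}^{∞} c k / (n + 1/2 - k)` converges to `h n`, the sum being the limit of the symmetric
partial sums (for summable `c` the series converges absolutely and this is its usual sum). -/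
def HasDiscreteHilbertTransform (c h : ℤ → ℂ) : Prop :=
  ∀ n : ℤ, Tendsto
    (fun N : ℕ => ∑ k ∈ Finset.Icc (-(N : ℤ)) (N : ℤ), c k / ((n : ℂ) + 1 / 2 - (k : ℂ)))
    atTop (𝓝 (h n))

/-- The series `∑ c k * exp (i k t)` is a Fourier series: there is an integrable function on the
circle `ℝ / 2πℤ` whose `k`-th Fourier coefficient (with respect to normalized Lebesgue measure)
is `c k` for every integer `k`. -/
def IsFourierSeries (c : ℤ → ℂ) : Prop :=
  haveI : Fact (0 < 2 * Real.pi) := ⟨Real.two_pi_pos⟩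
  ∃ f : AddCircle (2 * Real.pi) → ℂ,
    MeasureTheory.Integrable f AddCircle.haarAddCircle ∧ ∀ k : ℤ, fourierCoeff f k = c k

/-!
Put `D t = ∑ (c (k + 1) - c k) e^{ikt}`, an absolutely convergent series with `D 0 = 0`. If
`f = D / (e^{-it} - 1)` is integrable, then its Fourier coefficients have the same differences as
`c` and, like `c`, tend to zero; so they are equal to `c`. All the work is in the integrability
of `D t / t` at the origin.

Multiplied by `e^{it/2}`, a series with coefficients proportional to the discrete Hilbert transform
of `c (k + 1) - c k` sums to `sgn t * D t` on the period around the origin: this is the Fourier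
expansion of the square wave in half-integer frequencies. If the transform is summable, then
`F = D ± sgn * D` are absolutely convergent series of exponentials that vanish on one side of the
origin. Fejér means turn the samples `F (δ n)` into elements of the disc algebra that are bounded in
`L¹` by the sum of the coefficients of `F`, uniformly in `δ`, so Hardy's inequality
`∑ |F (δ n)| / n ≤ C` holds uniformly in `δ`. These are the Riemann sums of `∫ |F t| / t`.

In the second case the discrete Hilbert transform commutes with differences, which leads back to
the first.
-/

theorem sum_sum_mul_le_of_schur {ι κ : Type*} {s : Finset ι} {t : Finset κ} {K : ι → κ → ℝ}
    {p : ι → ℝ} {q : κ → ℝ} {A B : ℝ} (hK : ∀ i k, 0 ≤ K i k) (hp : ∀ i, 0 < p i)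
    (hq : ∀ k, 0 < q k) (hrow : ∀ i, ∑ k ∈ t, K i k * q k ≤ A * p i)
    (hcol : ∀ k, ∑ i ∈ s, K i k * p i ≤ B * q k) (x : ι → ℝ) (y : κ → ℝ) :
    ∑ i ∈ s, ∑ k ∈ t, K i k * (x i * y k) ≤
      A / 2 * ∑ i ∈ s, x i ^ 2 + B / 2 * ∑ k ∈ t, y k ^ 2 := by
  have weighted_amgm : ∀ i k, K i k * (x i * y k) ≤
      x i ^ 2 / (2 * p i) * (K i k * q k) + y k ^ 2 / (2 * q k) * (K i k * p i) := fun i k => by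
    have hpi := hp i
    have hqk := hq k
    have hsq : x i ^ 2 / (2 * p i) * (K i k * q k) + y k ^ 2 / (2 * q k) * (K i k * p i) -
        K i k * (x i * y k) = K i k * (x i * q k - y k * p i) ^ 2 / (2 * p i * q k) := by
      field_simp
      ring
    have := hK i k
    exact sub_nonneg.1 (hsq ▸ by positivity)
  calc ∑ i ∈ s, ∑ k ∈ t, K i k * (x i * y k)
      ≤ ∑ i ∈ s, ∑ k ∈ t,
          (x i ^ 2 / (2 * p i) * (K i k * q k) + y k ^ 2 / (2 * q k) * (K i k * p i)) :=
        Finset.sum_le_sum fun i _ => Finset.sum_le_sum fun k _ => weighted_amgm i k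
    _ = ∑ i ∈ s, x i ^ 2 / (2 * p i) * ∑ k ∈ t, K i k * q k +
          ∑ k ∈ t, y k ^ 2 / (2 * q k) * ∑ i ∈ s, K i k * p i := by
        simp_rw [Finset.sum_add_distrib, Finset.mul_sum]
        rw [Finset.sum_comm (s := t)]
    _ ≤ ∑ i ∈ s, x i ^ 2 / (2 * p i) * (A * p i) +
          ∑ k ∈ t, y k ^ 2 / (2 * q k) * (B * q k) := by
        gcongr with i _ k _
        · exact div_nonneg (sq_nonneg _) (mul_nonneg two_pos.le (hp i).le)
        · exact hrow i
        · exact div_nonneg (sq_nonneg _) (mul_nonneg two_pos.le (hq k).le)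
        · exact hcol k
    _ = A / 2 * ∑ i ∈ s, x i ^ 2 + B / 2 * ∑ k ∈ t, y k ^ 2 := by
        rw [Finset.mul_sum, Finset.mul_sum]
        congr 1 <;> refine Finset.sum_congr rfl fun i _ => ?_
        · have := (hp i).ne'
          field_simp
        · have := (hq i).ne'
          field_simp

theorem sum_inv_mul_inv_sqrt_le {b : ℝ} (hb : 1 ≤ b) (N : ℕ) :
    ∑ k ∈ Finset.range N, (b ^ 2 + k)⁻¹ * (√(k + 1))⁻¹ ≤ 8 * √N / (b * (√N + b)) := by
  induction N with
  | zero => simp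
  | succ n ih =>
    obtain ⟨a, ha⟩ : ∃ a, a = √(n : ℝ) := ⟨_, rfl⟩
    obtain ⟨a', ha'⟩ : ∃ a', a' = √((n : ℝ) + 1) := ⟨_, rfl⟩
    have ha0 : 0 ≤ a := ha ▸ Real.sqrt_nonneg _
    have ha'0 : 0 < a' := ha' ▸ Real.sqrt_pos.2 (by positivity)
    have hsq : a ^ 2 = n := ha ▸ Real.sq_sqrt n.cast_nonneg
    have hsq' : a' ^ 2 = a ^ 2 + 1 := by rw [hsq, ha', Real.sq_sqrt (by positivity)]
    have haa' : a ≤ a' := by nlinarith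
    have increment : (b ^ 2 + a ^ 2)⁻¹ * a'⁻¹ ≤
        8 * a' / (b * (a' + b)) - 8 * a / (b * (a + b)) := by
      have hdiff : 8 * a' / (b * (a' + b)) - 8 * a / (b * (a + b)) =
          8 * (a' - a) / ((a' + b) * (a + b)) := by
        field_simp
        ring
      have hstep : 1 ≤ (a' - a) * (2 * a') := by nlinarith
      have hden : (a' + b) * (a + b) ≤ 4 * (b ^ 2 + a ^ 2) := by nlinarith [sq_nonneg (a - b)]
      rw [hdiff, ← mul_inv, ← one_div, div_le_div_iff₀ (by positivity) (by positivity)]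
      nlinarith [mul_le_mul_of_nonneg_left hstep (by positivity : 0 ≤ 4 * (b ^ 2 + a ^ 2))]
    rw [Finset.sum_range_succ]
    push_cast
    rw [← ha'] at *
    rw [← ha] at ih
    rw [← hsq]
    linarith

theorem hilbert_inequality_range (x y : ℕ → ℝ) (N : ℕ) :
    ∑ j ∈ Finset.range N, ∑ k ∈ Finset.range N, x j * y k / ((j : ℝ) + k + 1) ≤
      4 * ∑ j ∈ Finset.range N, x j ^ 2 + 4 * ∑ k ∈ Finset.range N, y k ^ 2 := by
  have row (j : ℕ) : ∑ k ∈ Finset.range N, ((j : ℝ) + k + 1)⁻¹ * (√(k + 1))⁻¹ ≤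
      8 * (√(j + 1))⁻¹ := by
    have hb : 1 ≤ √((j : ℝ) + 1) := Real.one_le_sqrt.2 (by simp)
    have hb' : √((j : ℝ) + 1) ^ 2 = j + 1 := Real.sq_sqrt (by positivity)
    calc ∑ k ∈ Finset.range N, ((j : ℝ) + k + 1)⁻¹ * (√(k + 1))⁻¹
        = ∑ k ∈ Finset.range N, (√((j : ℝ) + 1) ^ 2 + k)⁻¹ * (√(k + 1))⁻¹ := by
          simp_rw [hb', add_right_comm]
      _ ≤ 8 * √N / (√(j + 1) * (√N + √(j + 1))) := sum_inv_mul_inv_sqrt_le hb N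
      _ ≤ 8 * (√(j + 1))⁻¹ := by
          rw [← div_eq_mul_inv, div_le_div_iff₀ (by positivity) (by positivity)]
          nlinarith [Real.sqrt_nonneg (N : ℝ)]
  have schur := sum_sum_mul_le_of_schur (s := Finset.range N) (t := Finset.range N)
    (K := fun j k => ((j : ℝ) + k + 1)⁻¹) (p := fun j => (√((j : ℝ) + 1))⁻¹)
    (q := fun k => (√((k : ℝ) + 1))⁻¹) (fun j k => by positivity) (fun j => by positivity)
    (fun k => by positivity) row (fun k => by simpa only [add_comm (k : ℝ)] using row k) x y
  norm_num only at schur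
  simpa only [div_eq_inv_mul] using schur

theorem sum_mul_antidiagonal_div_le {x y : ℕ → ℝ} (hx : ∀ j, 0 ≤ x j) (hy : ∀ j, 0 ≤ y j)
    (N : ℕ) :
    ∑ n ∈ Finset.range N,
        (∑ p ∈ Finset.HasAntidiagonal.antidiagonal n, x p.1 * y p.2) / ((n : ℝ) + 1) ≤
      ∑ j ∈ Finset.range N, ∑ k ∈ Finset.range N, x j * y k / ((j : ℝ) + k + 1) := by
  rw [← Finset.sum_product']
  set s := (Finset.range N ×ˢ Finset.range N).filter fun p => p.1 + p.2 < N
  calc ∑ n ∈ Finset.range N,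
        (∑ p ∈ Finset.HasAntidiagonal.antidiagonal n, x p.1 * y p.2) / ((n : ℝ) + 1)
      = ∑ n ∈ Finset.range N, ∑ p ∈ s with p.1 + p.2 = n,
          x p.1 * y p.2 / ((p.1 : ℝ) + p.2 + 1) := by
        refine Finset.sum_congr rfl fun n hn => ?_
        rw [Finset.mem_range] at hn
        rw [Finset.sum_div]
        refine Finset.sum_congr ?_ fun p hp => ?_
        · ext p
          simp only [Finset.HasAntidiagonal.mem_antidiagonal, Finset.mem_filter, Finset.mem_product,
            Finset.mem_range, s]
          omega
        · rw [← (Finset.mem_filter.1 hp).2, Nat.cast_add]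
    _ = ∑ p ∈ s, x p.1 * y p.2 / ((p.1 : ℝ) + p.2 + 1) :=
        Finset.sum_fiberwise_of_maps_to
          (fun p hp => Finset.mem_range.2 (Finset.mem_filter.1 hp).2) _
    _ ≤ ∑ p ∈ Finset.range N ×ˢ Finset.range N, x p.1 * y p.2 / ((p.1 : ℝ) + p.2 + 1) :=
        Finset.sum_le_sum_of_subset_of_nonneg (Finset.filter_subset _ _) fun p _ _ =>
          div_nonneg (mul_nonneg (hx _) (hy _)) (by positivity)

section DiscAlgebra

open MeasureTheory AddCircle

variable {T : ℝ}

variable (T) in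
/-- The disc algebra, realised on the boundary: uniform limits of polynomials in `fourier 1`. -/
noncomputable def discAlgebra : Subalgebra ℂ C(AddCircle T, ℂ) :=
  Algebra.elemental ℂ (fourier 1)

theorem fourier_natCast_eq_pow (k : ℕ) : (fourier k : C(AddCircle T, ℂ)) = fourier 1 ^ k := by
  ext x
  rw [ContinuousMap.pow_apply, fourier_one, fourier_apply, natCast_zsmul, toCircle_nsmul,
    Circle.coe_pow]

theorem fourier_natCast_mem_discAlgebra (k : ℕ) : fourier (k : ℤ) ∈ discAlgebra T := by
  rw [fourier_natCast_eq_pow]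
  exact pow_mem (Algebra.elemental.self_mem ℂ _) k

theorem eqOn_discAlgebra {L₁ L₂ : C(AddCircle T, ℂ) →L[ℂ] ℂ}
    (h : ∀ k : ℕ, L₁ (fourier k) = L₂ (fourier k)) {f : C(AddCircle T, ℂ)}
    (hf : f ∈ discAlgebra T) : L₁ f = L₂ f := by
  have eqOn_polynomials : Set.EqOn L₁ L₂ (Algebra.adjoin ℂ {(fourier 1 : C(AddCircle T, ℂ))}) := by
    intro g hg
    rw [SetLike.mem_coe, Algebra.adjoin_singleton_eq_range_aeval] at hg
    obtain ⟨p, rfl⟩ := hg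
    simp only [AlgHom.toRingHom_eq_coe, RingHom.coe_coe, Polynomial.aeval_eq_sum_range, map_sum,
      map_smul, ← fourier_natCast_eq_pow, h]
  exact eqOn_polynomials.closure L₁.continuous L₂.continuous hf

theorem exp_mem_discAlgebra {W : C(AddCircle T, ℂ)} (hW : W ∈ discAlgebra T) :
    NormedSpace.exp W ∈ discAlgebra T :=
  NormedSpace.exp_mem (R := ℂ) (Algebra.elemental.isClosed ℂ _) hW

theorem continuousMap_exp_apply {X : Type*} [TopologicalSpace X] [CompactSpace X] (f : C(X, ℂ))
    (x : X) : NormedSpace.exp f x = Complex.exp (f x) := by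
  rw [Complex.exp_eq_exp_ℂ]
  exact NormedSpace.map_exp (ContinuousMap.evalAlgHom ℂ ℂ x)
    (ContinuousEvalConst.continuous_eval_const x) f

theorem span_fourier_le_discAlgebra_sup_star :
    Submodule.span ℂ (Set.range (fourier (T := T))) ≤
      Subalgebra.toSubmodule (discAlgebra T) ⊔ Subalgebra.toSubmodule (star (discAlgebra T)) := by
  rw [Submodule.span_le]
  rintro _ ⟨n, rfl⟩
  obtain ⟨k, rfl | rfl⟩ := n.eq_nat_or_neg
  · exact Submodule.mem_sup_left (fourier_natCast_mem_discAlgebra k)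
  · have star_fourier : star (fourier (-k : ℤ)) = (fourier k : C(AddCircle T, ℂ)) := by
      ext x
      rw [ContinuousMap.star_apply, ← starRingEnd_apply, ← fourier_neg, neg_neg]
    refine Submodule.mem_sup_right ((Subalgebra.mem_star_iff (discAlgebra T) _).2 ?_)
    exact star_fourier ▸ fourier_natCast_mem_discAlgebra k

variable [Fact (0 < T)]

theorem exists_discAlgebra_two_mul_re_near (u : C(AddCircle T, ℝ)) :
    ∃ W ∈ discAlgebra T, ∀ x, |2 * (W x).re - u x| ≤ 1 := by
  let v : C(AddCircle T, ℂ) := ⟨fun x => (u x : ℂ), by fun_prop⟩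
  have hv : v ∈ closure (Submodule.span ℂ (Set.range (fourier (T := T))) : Set _) := by
    rw [← Submodule.topologicalClosure_coe, span_fourier_closure_eq_top]
    trivial
  obtain ⟨q, hq, hdist⟩ := Metric.mem_closure_iff.1 hv 1 one_pos
  obtain ⟨U, hU, V, hV, rfl⟩ := Submodule.mem_sup.1 (span_fourier_le_discAlgebra_sup_star hq)
  have hV' : star V ∈ discAlgebra T := (Subalgebra.mem_star_iff _ _).1 hV
  refine ⟨(2⁻¹ : ℂ) • (U + star V), Subalgebra.smul_mem _ (add_mem hU hV') _, fun x => ?_⟩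
  calc |2 * (((2⁻¹ : ℂ) • (U + star V)) x).re - u x|
      = |((U + V - v) x).re| := by simp [v, ← mul_add]
    _ ≤ ‖U + V - v‖ := (Complex.abs_re_le_norm _).trans ((U + V - v).norm_coe_le_norm x)
    _ ≤ 1 := by
      rw [← dist_eq_norm, dist_comm]
      exact hdist.le

/- `G = exp W` replaces the square root of the outer factor of `f`: since only the size of `G` and
`K` matters, `2 Re W` need only be within `1` of `log ρ`, and no conjugate function is required. -/
theorem exists_discAlgebra_factorization {f : C(AddCircle T, ℂ)} (hf : f ∈ discAlgebra T)
    {ρ : C(AddCircle T, ℝ)} (hρ : ∀ x, 0 < ρ x) (hfρ : ∀ x, ‖f x‖ ≤ ρ x) :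
    ∃ G ∈ discAlgebra T, ∃ K ∈ discAlgebra T, f = G * K ∧
      (∀ x, ‖G x‖ ^ 2 ≤ Real.exp 1 * ρ x) ∧ ∀ x, ‖K x‖ ^ 2 ≤ Real.exp 1 * ρ x := by
  obtain ⟨W, hW, hnear⟩ :
      ∃ W ∈ discAlgebra T, ∀ x, |2 * (W x).re - Real.log (ρ x)| ≤ 1 :=
    exists_discAlgebra_two_mul_re_near ⟨_, ρ.continuous.log fun x => (hρ x).ne'⟩
  have norm_exp_sq (z : ℂ) : ‖Complex.exp z‖ ^ 2 = Real.exp (2 * z.re) := by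
    rw [Complex.norm_exp, ← Real.exp_nat_mul, Nat.cast_ofNat]
  refine ⟨NormedSpace.exp W, exp_mem_discAlgebra hW, f * NormedSpace.exp (-W),
    mul_mem hf (exp_mem_discAlgebra (neg_mem hW)), ?_, fun x => ?_, fun x => ?_⟩
  · ext x
    simp only [ContinuousMap.mul_apply, continuousMap_exp_apply, ContinuousMap.neg_apply]
    rw [mul_left_comm, ← Complex.exp_add, add_neg_cancel, Complex.exp_zero, mul_one]
  · calc ‖NormedSpace.exp W x‖ ^ 2 = Real.exp (2 * (W x).re) := by
          rw [continuousMap_exp_apply, norm_exp_sq]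
      _ ≤ Real.exp (1 + Real.log (ρ x)) :=
          Real.exp_le_exp.2 (sub_le_iff_le_add.1 (abs_le.1 (hnear x)).2)
      _ = Real.exp 1 * ρ x := by rw [Real.exp_add, Real.exp_log (hρ x)]
  · calc ‖(f * NormedSpace.exp (-W)) x‖ ^ 2 = ‖f x‖ ^ 2 * Real.exp (-(2 * (W x).re)) := by
          rw [ContinuousMap.mul_apply, norm_mul, mul_pow, continuousMap_exp_apply, norm_exp_sq,
            ContinuousMap.neg_apply, Complex.neg_re, mul_neg]
      _ ≤ ρ x ^ 2 * Real.exp (1 - Real.log (ρ x)) := by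
          gcongr
          · exact hfρ x
          · linarith only [(abs_le.1 (hnear x)).1]
      _ = Real.exp 1 * ρ x := by
          rw [Real.exp_sub, Real.exp_log (hρ x)]
          have := (hρ x).ne'
          field_simp

theorem integrable_haarAddCircle_of_continuous {E : Type*} [NormedAddCommGroup E]
    {f : AddCircle T → E} (hf : Continuous f) : Integrable f haarAddCircle :=
  hf.integrable_of_hasCompactSupport (HasCompactSupport.of_compactSpace f)

theorem integrable_mul_continuousMap {θ : AddCircle T → ℂ} (hθ : Integrable θ haarAddCircle)
    (f : C(AddCircle T, ℂ)) : Integrable (fun x => θ x * f x) haarAddCircle :=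
  hθ.mul_bdd f.continuous.aestronglyMeasurable (.of_forall f.norm_coe_le_norm)

/-- The continuous linear functional `f ↦ fourierCoeff (θ * f) n` on continuous functions, for an
integrable weight `θ`. -/
noncomputable def fourierCoeffMulCLM {θ : AddCircle T → ℂ} (hθ : Integrable θ haarAddCircle)
    (n : ℤ) : C(AddCircle T, ℂ) →L[ℂ] ℂ :=
  LinearMap.mkContinuous
    { toFun := fun f => fourierCoeff (fun x => θ x * f x) n
      map_add' := fun f g => by
        have := congrFun (fourierCoeff.add (integrable_mul_continuousMap hθ f)
          (integrable_mul_continuousMap hθ g)) n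
        simpa only [ContinuousMap.add_apply, mul_add, Pi.add_def] using this
      map_smul' := fun c f => by
        simpa only [ContinuousMap.smul_apply, smul_eq_mul, mul_left_comm, RingHom.id_apply,
          Pi.smul_def]
          using fourierCoeff.const_smul (fun x => θ x * f x) c n }
    (∫ x, ‖θ x‖ ∂haarAddCircle) fun f => by
      rw [← integral_mul_const]
      refine norm_integral_le_of_norm_le (hθ.norm.mul_const _) (.of_forall fun x => ?_)
      rw [norm_smul, norm_mul, fourier_apply, Circle.norm_coe, one_mul]
      exact mul_le_mul_of_nonneg_left (f.norm_coe_le_norm x) (norm_nonneg _)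

theorem fourierCoeffMulCLM_apply {θ : AddCircle T → ℂ} (hθ : Integrable θ haarAddCircle) (n : ℤ)
    (f : C(AddCircle T, ℂ)) :
    fourierCoeffMulCLM hθ n f = fourierCoeff (fun x => θ x * f x) n :=
  rfl

theorem fourierCoeff_mul_fourier (g : AddCircle T → ℂ) (m n : ℤ) :
    fourierCoeff (fun x => g x * fourier m x) n = fourierCoeff g (n - m) := by
  refine integral_congr_ae (.of_forall fun x => ?_)
  simp only [smul_eq_mul]
  rw [neg_sub, sub_eq_neg_add, fourier_add]
  ring

theorem hasSum_fourierCoeff_mul {ι : Type*} {θ : AddCircle T → ℂ}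
    (hθ : Integrable θ haarAddCircle) {d : ι → ℂ} {m : ι → ℤ} {D : C(AddCircle T, ℂ)}
    (hD : HasSum (fun k => d k • (fourier (m k) : C(AddCircle T, ℂ))) D) (n : ℤ) :
    HasSum (fun k => d k * fourierCoeff θ (n - m k)) (fourierCoeff (fun x => θ x * D x) n) := by
  have h := hD.mapL (fourierCoeffMulCLM hθ n)
  simpa only [map_smul, fourierCoeffMulCLM_apply, fourierCoeff_mul_fourier, smul_eq_mul] using h

/-- The `n`-th Fourier coefficient as a continuous linear functional on continuous functions. -/
noncomputable def fourierCoeffCLM (n : ℤ) : C(AddCircle T, ℂ) →L[ℂ] ℂ :=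
  fourierCoeffMulCLM (integrable_const 1) n

theorem fourierCoeffCLM_apply (n : ℤ) (f : C(AddCircle T, ℂ)) :
    fourierCoeffCLM n f = fourierCoeff f n := by
  simp only [fourierCoeffCLM, fourierCoeffMulCLM_apply, one_mul]

theorem fourierCoeff_of_mem_discAlgebra_of_neg {f : C(AddCircle T, ℂ)} (hf : f ∈ discAlgebra T)
    {n : ℤ} (hn : n < 0) : fourierCoeff f n = 0 := by
  rw [← fourierCoeffCLM_apply]
  refine eqOn_discAlgebra (L₁ := fourierCoeffCLM n) (L₂ := 0) (fun k => ?_) hf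
  rw [fourierCoeffCLM_apply, fourierCoeff_fourier, zero_apply]
  exact Pi.single_eq_of_ne (by omega) _

theorem fourierCoeff_mul_of_mem_discAlgebra {f g : C(AddCircle T, ℂ)} (hf : f ∈ discAlgebra T)
    (hg : g ∈ discAlgebra T) (n : ℕ) :
    fourierCoeff (f * g : C(AddCircle T, ℂ)) n =
      ∑ p ∈ Finset.HasAntidiagonal.antidiagonal n,
        fourierCoeff f p.1 * fourierCoeff g p.2 := by
  have hfi : Integrable f haarAddCircle := integrable_haarAddCircle_of_continuous f.continuous
  have on_fourier (k : ℕ) : fourierCoeffMulCLM hfi n (fourier k) =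
      (∑ i ∈ Finset.range (n + 1),
        fourierCoeff f i • fourierCoeffCLM (T := T) (n - i : ℕ)) (fourier k) := by
    simp only [fourierCoeffMulCLM_apply, fourierCoeff_mul_fourier, sum_apply,
      smul_apply, fourierCoeffCLM_apply, fourierCoeff_fourier, smul_eq_mul,
      Pi.single_apply, mul_ite, mul_one, mul_zero]
    rcases le_or_gt k n with hkn | hkn
    · rw [Finset.sum_eq_single_of_mem (n - k) (by simp), if_pos (by omega),
        Nat.cast_sub hkn]
      exact fun i _ hi => if_neg (by rw [Finset.mem_range] at *; omega)
    · rw [fourierCoeff_of_mem_discAlgebra_of_neg hf (by omega)]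
      exact (Finset.sum_eq_zero fun i _ => if_neg (by omega)).symm
  rw [Finset.Nat.sum_antidiagonal_eq_sum_range_succ
    (fun i j => fourierCoeff f i * fourierCoeff g j)]
  simpa only [fourierCoeffMulCLM_apply, sum_apply, smul_apply, fourierCoeffCLM_apply, smul_eq_mul,
    ContinuousMap.coe_mul, Pi.mul_def] using eqOn_discAlgebra on_fourier hg

theorem sum_sq_norm_fourierCoeff_le (f : C(AddCircle T, ℂ)) (N : ℕ) :
    ∑ n ∈ Finset.range N, ‖fourierCoeff f n‖ ^ 2 ≤ ∫ x, ‖f x‖ ^ 2 ∂haarAddCircle := by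
  have parseval := hasSum_sq_fourierCoeff (ContinuousMap.toLp (E := ℂ) 2 haarAddCircle ℂ f)
  simp_rw [fourierCoeff_toLp] at parseval
  have bessel := sum_le_hasSum ((Finset.range N).map Nat.castEmbedding)
    (fun _ _ => by positivity) parseval
  rw [Finset.sum_map] at bessel
  refine bessel.trans_eq (integral_congr_ae ?_)
  filter_upwards [ContinuousMap.coeFn_toLp (p := 2) haarAddCircle (𝕜 := ℂ) f] with x hx
  rw [hx]

theorem sum_norm_fourierCoeff_mul_div_le {G K : C(AddCircle T, ℂ)} (hG : G ∈ discAlgebra T)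
    (hK : K ∈ discAlgebra T) (N : ℕ) :
    ∑ n ∈ Finset.range N, ‖fourierCoeff (G * K : C(AddCircle T, ℂ)) n‖ / ((n : ℝ) + 1) ≤
      4 * ∫ x, ‖G x‖ ^ 2 ∂haarAddCircle + 4 * ∫ x, ‖K x‖ ^ 2 ∂haarAddCircle :=
  calc ∑ n ∈ Finset.range N, ‖fourierCoeff (G * K : C(AddCircle T, ℂ)) n‖ / ((n : ℝ) + 1)
      ≤ ∑ n ∈ Finset.range N, (∑ p ∈ Finset.HasAntidiagonal.antidiagonal n,
          ‖fourierCoeff G p.1‖ * ‖fourierCoeff K p.2‖) / ((n : ℝ) + 1) := by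
        gcongr with n _
        rw [fourierCoeff_mul_of_mem_discAlgebra hG hK n]
        exact (norm_sum_le _ _).trans_eq (Finset.sum_congr rfl fun _ _ => norm_mul _ _)
    _ ≤ ∑ j ∈ Finset.range N, ∑ k ∈ Finset.range N,
          ‖fourierCoeff G j‖ * ‖fourierCoeff K k‖ / ((j : ℝ) + k + 1) :=
        sum_mul_antidiagonal_div_le (x := fun j => ‖fourierCoeff G j‖)
          (y := fun k => ‖fourierCoeff K k‖) (fun _ => norm_nonneg _) (fun _ => norm_nonneg _) N
    _ ≤ 4 * ∑ j ∈ Finset.range N, ‖fourierCoeff G j‖ ^ 2 +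
          4 * ∑ k ∈ Finset.range N, ‖fourierCoeff K k‖ ^ 2 :=
        hilbert_inequality_range _ _ N
    _ ≤ 4 * ∫ x, ‖G x‖ ^ 2 ∂haarAddCircle + 4 * ∫ x, ‖K x‖ ^ 2 ∂haarAddCircle := by
        gcongr <;> exact sum_sq_norm_fourierCoeff_le _ N

theorem hardy_inequality_discAlgebra {f : C(AddCircle T, ℂ)}
    (hf : f ∈ discAlgebra T) (N : ℕ) :
    ∑ n ∈ Finset.range N, ‖fourierCoeff f n‖ / ((n : ℝ) + 1) ≤
      8 * Real.exp 1 * ∫ x, ‖f x‖ ∂haarAddCircle := by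
  rw [← div_le_iff₀' (by positivity)]
  refine le_of_forall_pos_le_add fun δ hδ => ?_
  rw [div_le_iff₀' (by positivity)]
  obtain ⟨G, hG, K, hK, rfl, hGx, hKx⟩ := exists_discAlgebra_factorization hf
    (ρ := ⟨fun x => ‖f x‖ + δ, by fun_prop⟩)
    (fun x => add_pos_of_nonneg_of_pos (norm_nonneg _) hδ) fun x => le_add_of_nonneg_right hδ.le
  have integral_sq_le {g : C(AddCircle T, ℂ)}
      (hg : ∀ x, ‖g x‖ ^ 2 ≤ Real.exp 1 * (‖(G * K) x‖ + δ)) :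
      ∫ x, ‖g x‖ ^ 2 ∂haarAddCircle ≤
        Real.exp 1 * ((∫ x, ‖(G * K) x‖ ∂haarAddCircle) + δ) := by
    have hint : Integrable (fun x => ‖(G * K) x‖) (haarAddCircle (T := T)) :=
      integrable_haarAddCircle_of_continuous (by fun_prop)
    calc ∫ x, ‖g x‖ ^ 2 ∂haarAddCircle
        ≤ ∫ x, Real.exp 1 * (‖(G * K) x‖ + δ) ∂haarAddCircle :=
          integral_mono (integrable_haarAddCircle_of_continuous (by fun_prop))
            (integrable_haarAddCircle_of_continuous (by fun_prop)) hg
      _ = Real.exp 1 * ((∫ x, ‖(G * K) x‖ ∂haarAddCircle) + δ) := by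
          rw [integral_const_mul, integral_add hint (integrable_const δ), integral_const,
            probReal_univ, one_smul]
  linarith [sum_norm_fourierCoeff_mul_div_le hG hK N, integral_sq_le hGx, integral_sq_le hKx]

end DiscAlgebra

section FejerMean

open MeasureTheory AddCircle

variable {T : ℝ}

variable (T) in
/-- The Fejér mean `∑ₘ (1 - |m| / N) φ m e_m` of the formal series `∑ₘ φ m e_m`, where
`e_m = fourier m`. Summing over pairs `p, q < N` with `p - q = m` produces the Fejér weights. -/
noncomputable def fejerMean (φ : ℤ → ℂ) (N : ℕ) : C(AddCircle T, ℂ) :=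
  (N : ℂ)⁻¹ • ∑ p ∈ Finset.range N, ∑ q ∈ Finset.range N, φ ((p : ℤ) - q) • fourier ((p : ℤ) - q)

theorem fejerMean_mem_discAlgebra {φ : ℤ → ℂ} {N : ℕ} (hφ : ∀ m : ℤ, -N < m → m ≤ 0 → φ m = 0) :
    fejerMean T φ N ∈ discAlgebra T := by
  refine Subalgebra.smul_mem _ (sum_mem fun p hp => sum_mem fun q hq => ?_) _
  rw [Finset.mem_range] at hp hq
  dsimp only
  rcases le_or_gt p q with hpq | hqp
  · rw [hφ _ (by omega) (by omega)]
    exact (zero_smul ℂ (fourier ((p : ℤ) - q) : C(AddCircle T, ℂ))).symm ▸ zero_mem _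
  · rw [← Nat.cast_sub hqp.le]
    exact Subalgebra.smul_mem _ (fourier_natCast_mem_discAlgebra _) _

theorem hasSum_fejerMean {ι : Type*} {a : ι → ℂ} {ψ : ι → ℤ → ℂ} {φ : ℤ → ℂ}
    (h : ∀ m, HasSum (fun j => a j * ψ j m) (φ m)) (N : ℕ) :
    HasSum (fun j => a j • fejerMean T (ψ j) N) (fejerMean T φ N) := by
  simp only [fejerMean, smul_comm (a _) (N : ℂ)⁻¹, Finset.smul_sum (r := a _), smul_smul (a _)]
  exact (hasSum_sum fun p _ => hasSum_sum fun q _ => (h _).smul_const _).const_smul _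

theorem fejerMean_zpow_apply (w : Circle) (N : ℕ) (x : AddCircle T) :
    fejerMean T (fun m => (w ^ m : Circle)) N x =
      ((N : ℝ)⁻¹ * ‖∑ p ∈ Finset.range N, ((w * toCircle x : Circle) : ℂ) ^ p‖ ^ 2 : ℝ) := by
  have term (p q : ℕ) : ((w ^ ((p : ℤ) - q) : Circle) : ℂ) * fourier ((p : ℤ) - q) x =
      ((w * toCircle x : Circle) : ℂ) ^ p *
        starRingEnd ℂ (((w * toCircle x : Circle) : ℂ) ^ q) := by
    rw [fourier_apply, toCircle_zsmul, ← Circle.coe_mul, ← mul_zpow, zpow_sub, zpow_natCast,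
      zpow_natCast, Circle.coe_mul, Circle.coe_inv_eq_conj, Circle.coe_pow, Circle.coe_pow]
  rw [Complex.ofReal_mul, Complex.ofReal_pow, ← Complex.mul_conj', map_sum, Finset.sum_mul_sum]
  simp only [fejerMean, ContinuousMap.smul_apply, ContinuousMap.sum_apply, smul_eq_mul, term,
    Complex.ofReal_inv, Complex.ofReal_natCast]

variable [Fact (0 < T)]

theorem fourierCoeff_fejerMean (φ : ℤ → ℂ) {N n : ℕ} (hn : n < N) :
    fourierCoeff (fejerMean T φ N) n = (1 - (n : ℂ) / N) * φ n := by
  have hN : (N : ℂ) ≠ 0 := Nat.cast_ne_zero.2 (by omega)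
  have weight (q : ℕ) : ∑ p ∈ Finset.range N,
      φ ((p : ℤ) - q) * (Pi.single ((p : ℤ) - q) (1 : ℂ) : ℤ → ℂ) n =
        if q + n < N then φ n else 0 :=
    calc ∑ p ∈ Finset.range N, φ ((p : ℤ) - q) * (Pi.single ((p : ℤ) - q) (1 : ℂ) : ℤ → ℂ) n
        = ∑ p ∈ Finset.range N, if p = q + n then φ n else 0 := by
          refine Finset.sum_congr rfl fun p _ => ?_
          split_ifs with hp
          · rw [show (p : ℤ) - q = n by omega, Pi.single_eq_same, mul_one]
          · rw [Pi.single_eq_of_ne (by omega), mul_zero]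
      _ = if q + n < N then φ n else 0 := by
          rw [Finset.sum_ite_eq']
          simp only [Finset.mem_range]
  have hcard : (Finset.range N).filter (fun q => q + n < N) = Finset.range (N - n) := by
    ext q
    simp only [Finset.mem_filter, Finset.mem_range]
    omega
  rw [← fourierCoeffCLM_apply, fejerMean, map_smul, map_sum]
  simp_rw [map_sum, map_smul, fourierCoeffCLM_apply, fourierCoeff_fourier, smul_eq_mul]
  rw [Finset.sum_comm]
  simp_rw [weight]
  rw [← Finset.sum_filter, hcard, Finset.sum_const, Finset.card_range, nsmul_eq_mul,
    Nat.cast_sub hn.le]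
  field_simp

theorem norm_le_two_mul_norm_fourierCoeff_fejerMean (φ : ℤ → ℂ) {N n : ℕ} (hN : 0 < N)
    (hn : 2 * n ≤ N) : ‖φ n‖ ≤ 2 * ‖fourierCoeff (fejerMean T φ N) n‖ := by
  have half_le : (1 / 2 : ℝ) ≤ 1 - (n : ℝ) / N := by
    have : (2 * n : ℝ) ≤ N := by exact_mod_cast hn
    have : (n : ℝ) / N ≤ 1 / 2 := by
      rw [div_le_div_iff₀ (by positivity) two_pos]
      linarith
    linarith
  have norm_weight : ‖1 - (n : ℂ) / N‖ = 1 - (n : ℝ) / N := by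
    rw [← Complex.norm_of_nonneg (one_half_pos.le.trans half_le)]
    push_cast
    rfl
  rw [fourierCoeff_fejerMean φ (by omega), norm_mul, norm_weight]
  nlinarith [norm_nonneg (φ n)]

/- The mean of the character `m ↦ w ^ m` is a translate of the Fejér kernel: it is nonnegative, so
its `L¹` norm is its zeroth coefficient. -/
theorem integral_norm_fejerMean_zpow (w : Circle) {N : ℕ} (hN : 0 < N) :
    ∫ x, ‖fejerMean T (fun m => (w ^ m : Circle)) N x‖ ∂haarAddCircle = 1 := by
  have norm_eq (x : AddCircle T) : (‖fejerMean T (fun m => (w ^ m : Circle)) N x‖ : ℂ) =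
      fejerMean T (fun m => (w ^ m : Circle)) N x := by
    rw [fejerMean_zpow_apply, Complex.norm_of_nonneg (by positivity)]
  apply Complex.ofReal_injective
  have coeff_zero := fourierCoeff_fejerMean (T := T) (fun m => ((w ^ m : Circle) : ℂ)) hN
  simp only [fourierCoeff, Nat.cast_zero, neg_zero, fourier_zero, one_smul, zero_div, sub_zero,
    zpow_zero, Circle.coe_one, mul_one] at coeff_zero
  rw [← integral_complex_ofReal, integral_congr_ae (.of_forall norm_eq), coeff_zero,
    Complex.ofReal_one]

theorem integral_norm_le_of_hasSum {ι : Type*} {u : ι → C(AddCircle T, ℂ)} {f : C(AddCircle T, ℂ)}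
    {b : ι → ℝ} {B : ℝ} (hu : HasSum u f) (hb : HasSum b B)
    (hub : ∀ j, ∫ x, ‖u j x‖ ∂haarAddCircle ≤ b j) : ∫ x, ‖f x‖ ∂haarAddCircle ≤ B := by
  have norm_toLp (g : C(AddCircle T, ℂ)) :
      ‖ContinuousMap.toLp (E := ℂ) 1 haarAddCircle ℂ g‖ = ∫ x, ‖g x‖ ∂haarAddCircle := by
    rw [L1.norm_eq_integral_norm]
    refine integral_congr_ae ?_
    filter_upwards [ContinuousMap.coeFn_toLp (p := 1) haarAddCircle (𝕜 := ℂ) g] with x hx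
    rw [hx]
  rw [← norm_toLp]
  exact (hu.mapL (ContinuousMap.toLp (E := ℂ) 1 haarAddCircle ℂ)).norm_le_of_bounded hb
    fun j => (norm_toLp (u j)).trans_le (hub j)

theorem integral_norm_fejerMean_le {ι : Type*} {a : ι → ℂ} (ha : Summable fun j => ‖a j‖)
    {w : ι → Circle} {φ : ℤ → ℂ} (hφ : ∀ m, HasSum (fun j => a j * (w j ^ m : Circle)) (φ m))
    {N : ℕ} (hN : 0 < N) : ∫ x, ‖fejerMean T φ N x‖ ∂haarAddCircle ≤ ∑' j, ‖a j‖ := by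
  refine integral_norm_le_of_hasSum (hasSum_fejerMean hφ N) ha.hasSum fun j => le_of_eq ?_
  simp only [ContinuousMap.smul_apply, norm_smul, integral_const_mul,
    integral_norm_fejerMean_zpow (w j) hN, mul_one]

end FejerMean

theorem sum_norm_div_le_of_vanishing {ι : Type*} {a : ι → ℂ} (ha : Summable fun j => ‖a j‖)
    {w : ι → Circle} {φ : ℤ → ℂ} (hφ : ∀ m, HasSum (fun j => a j * (w j ^ m : Circle)) (φ m))
    {K : ℕ} (h0 : ∀ m : ℤ, -(2 * K : ℕ) < m → m ≤ 0 → φ m = 0) :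
    ∑ n ∈ Finset.range K, ‖φ (n + 1)‖ / ((n : ℝ) + 1) ≤ 32 * Real.exp 1 * ∑' j, ‖a j‖ := by
  obtain rfl | hK := K.eq_zero_or_pos
  · rw [Finset.sum_range_zero]
    positivity
  have : Fact ((0 : ℝ) < 1) := ⟨one_pos⟩
  set f := fejerMean 1 φ (2 * K)
  have hardy : ∑ n ∈ Finset.range (K + 1), ‖fourierCoeff f n‖ / ((n : ℝ) + 1) ≤
      8 * Real.exp 1 * ∑' j, ‖a j‖ :=
    (hardy_inequality_discAlgebra (fejerMean_mem_discAlgebra h0) _).trans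
      (by gcongr; exact integral_norm_fejerMean_le ha hφ (by omega))
  calc ∑ n ∈ Finset.range K, ‖φ (n + 1)‖ / ((n : ℝ) + 1)
      ≤ ∑ n ∈ Finset.range K, 4 * (‖fourierCoeff f (n + 1 : ℕ)‖ / ((n + 1 : ℕ) + 1 : ℝ)) := by
        refine Finset.sum_le_sum fun n hn => ?_
        rw [Finset.mem_range] at hn
        have : ‖φ (n + 1)‖ ≤ 2 * ‖fourierCoeff f (n + 1 : ℕ)‖ :=
          norm_le_two_mul_norm_fourierCoeff_fejerMean φ (n := n + 1) (by omega) (by omega)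
        rw [← mul_div_assoc, div_le_div_iff₀ (by positivity) (by positivity), Nat.cast_succ]
        nlinarith [norm_nonneg (φ (n + 1)), n.cast_nonneg (α := ℝ)]
    _ ≤ 4 * ∑ n ∈ Finset.range (K + 1), ‖fourierCoeff f n‖ / ((n : ℝ) + 1) := by
        rw [← Finset.mul_sum, Finset.sum_range_succ']
        gcongr
        exact le_add_of_nonneg_right (by positivity)
    _ ≤ 4 * (8 * Real.exp 1 * ∑' j, ‖a j‖) := by gcongr
    _ = 32 * Real.exp 1 * ∑' j, ‖a j‖ := by ring

section RiemannSum

open MeasureTheory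

theorem lintegral_Ioc_nat_ceil (f : ℕ → ENNReal) {δ : ℝ} (hδ : 0 < δ) (K : ℕ) :
    ∫⁻ s in Set.Ioc 0 (K * δ), f ⌈s / δ⌉₊ = ∑ n ∈ Finset.range K, ENNReal.ofReal δ * f (n + 1) := by
  induction K with
  | zero => simp
  | succ K ih =>
    have hlast : ∫⁻ s in Set.Ioc (K * δ) ((K + 1 : ℕ) * δ), f ⌈s / δ⌉₊ =
        ENNReal.ofReal δ * f (K + 1) := by
      have hceil : ∀ s ∈ Set.Ioc (K * δ) ((K + 1 : ℕ) * δ), f ⌈s / δ⌉₊ = f (K + 1) := by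
        intro s hs
        rw [(Nat.ceil_eq_iff K.succ_ne_zero).2 ⟨(lt_div_iff₀ hδ).2 hs.1, (div_le_iff₀ hδ).2 hs.2⟩]
      rw [setLIntegral_congr_fun measurableSet_Ioc hceil, setLIntegral_const, Real.volume_Ioc,
        Nat.cast_succ, add_one_mul, add_sub_cancel_left, mul_comm]
    rw [Finset.sum_range_succ, ← ih, ← hlast, ← lintegral_union measurableSet_Ioc
      (Set.Ioc_disjoint_Ioc_of_le le_rfl),
      Set.Ioc_union_Ioc_eq_Ioc (by positivity) (by gcongr; exact K.le_succ)]

/- Fatou's lemma for the step functions that sample `G` at the right endpoints of the `K` equal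
subintervals. -/
theorem lintegral_Ioc_le_of_riemann_sum_le {G : ℝ → ENNReal} {b : ℝ} (hb : 0 < b)
    (hG : ∀ s, 0 < s → ContinuousAt G s) {C : ENNReal}
    (hC : ∀ K : ℕ, 0 < K →
      ∑ n ∈ Finset.range K, ENNReal.ofReal (b / K) * G ((n + 1 : ℕ) * (b / K)) ≤ C) :
    ∫⁻ s in Set.Ioc 0 b, G s ≤ C := by
  let step : ℕ → ℝ → ENNReal := fun K s => G (⌈s / (b / K)⌉₊ * (b / K))
  have step_tendsto : ∀ s ∈ Set.Ioc 0 b, liminf (fun K => step K s) atTop = G s := by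
    intro s hs
    have hK : Tendsto (fun K : ℕ => (K : ℝ) / b) atTop atTop :=
      tendsto_natCast_atTop_atTop.atTop_div_const hb
    have := (tendsto_nat_ceil_mul_div_atTop hs.1.le).comp hK
    refine ((hG s hs.1).tendsto.comp (this.congr fun K => ?_)).liminf_eq
    rw [Function.comp_apply, div_eq_mul_inv s, inv_div, div_eq_mul_inv _ ((K : ℝ) / b), inv_div]
  have step_measurable (K : ℕ) : Measurable (step K) :=
    (measurable_from_nat (f := fun n : ℕ => G (n * (b / K)))).comp
      (Nat.measurable_ceil.comp (measurable_id.div_const _))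
  calc ∫⁻ s in Set.Ioc 0 b, G s
      = ∫⁻ s in Set.Ioc 0 b, liminf (fun K => step K s) atTop :=
        (setLIntegral_congr_fun measurableSet_Ioc step_tendsto).symm
    _ ≤ liminf (fun K => ∫⁻ s in Set.Ioc 0 b, step K s) atTop := lintegral_liminf_le step_measurable
    _ ≤ liminf (fun _ : ℕ => C) atTop := by
        refine liminf_le_liminf ?_
        filter_upwards [eventually_gt_atTop 0] with K hK
        have hK' : (0 : ℝ) < K := Nat.cast_pos.2 hK
        have := lintegral_Ioc_nat_ceil (fun n => G (n * (b / K))) (div_pos hb hK') K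
        rw [mul_div_cancel₀ b hK'.ne'] at this
        exact this.trans_le (hC K hK)
    _ = C := liminf_const C

/-- `F` is the sum of an absolutely convergent series of exponentials with arbitrary real
frequencies, i.e. the Fourier transform of a finite discrete complex measure on the line. -/
def IsAbsConvExpSeries (F : ℝ → ℂ) : Prop :=
  ∃ (ι : Type) (a : ι → ℂ) (ξ : ι → ℝ), (Summable fun j => ‖a j‖) ∧
    ∀ s : ℝ, HasSum (fun j => a j * Complex.exp (ξ j * s * Complex.I)) (F s)

namespace IsAbsConvExpSeries

variable {F G : ℝ → ℂ}

theorem continuous (hF : IsAbsConvExpSeries F) : Continuous F := by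
  obtain ⟨ι, a, ξ, ha, hF⟩ := hF
  rw [show F = fun s : ℝ => ∑' j, a j * Complex.exp (ξ j * s * Complex.I) from
    funext fun s => (hF s).tsum_eq.symm]
  refine continuous_tsum (fun j => by fun_prop) ha fun j s => ?_
  rw [norm_mul, ← Complex.ofReal_mul, Complex.norm_exp_ofReal_mul_I, mul_one]

theorem add (hF : IsAbsConvExpSeries F) (hG : IsAbsConvExpSeries G) :
    IsAbsConvExpSeries fun s => F s + G s := by
  obtain ⟨ι, a, ξ, ha, hF⟩ := hF
  obtain ⟨κ, b, η, hb, hG⟩ := hG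
  refine ⟨ι ⊕ κ, Sum.elim a b, Sum.elim ξ η, ?_, fun s => (hF s).sum (hG s)⟩
  exact (ha.hasSum.sum (f := fun j => ‖Sum.elim a b j‖) hb.hasSum).summable

theorem neg (hF : IsAbsConvExpSeries F) : IsAbsConvExpSeries fun s => -F s := by
  obtain ⟨ι, a, ξ, ha, hF⟩ := hF
  exact ⟨ι, fun j => -a j, ξ, by simpa only [norm_neg] using ha,
    fun s => by simpa only [neg_mul] using (hF s).neg⟩

theorem comp_neg (hF : IsAbsConvExpSeries F) : IsAbsConvExpSeries fun s => F (-s) := by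
  obtain ⟨ι, a, ξ, ha, hF⟩ := hF
  refine ⟨ι, a, fun j => -ξ j, ha, fun s => ?_⟩
  simpa only [Complex.ofReal_neg, mul_neg, neg_mul] using hF (-s)

theorem exp_mul (hF : IsAbsConvExpSeries F) (η : ℝ) :
    IsAbsConvExpSeries fun s => Complex.exp (η * s * Complex.I) * F s := by
  obtain ⟨ι, a, ξ, ha, hF⟩ := hF
  refine ⟨ι, a, fun j => η + ξ j, ha, fun s => ?_⟩
  simpa only [Complex.ofReal_add, add_mul, Complex.exp_add, mul_left_comm] using
    (hF s).mul_left (Complex.exp (η * s * Complex.I))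

theorem sum_norm_sample_div_le {ι : Type*} {a : ι → ℂ} {ξ : ι → ℝ} (ha : Summable fun j => ‖a j‖)
    (hF : ∀ s : ℝ, HasSum (fun j => a j * Complex.exp (ξ j * s * Complex.I)) (F s)) {δ : ℝ}
    (hδ : 0 < δ) {K : ℕ} (h0 : ∀ s ∈ Set.Ioc (-(2 * (K * δ))) 0, F s = 0) :
    ∑ n ∈ Finset.range K, ‖F ((n + 1 : ℕ) * δ)‖ / ((n : ℝ) + 1) ≤
      32 * Real.exp 1 * ∑' j, ‖a j‖ := by
  have hsample (m : ℤ) :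
      HasSum (fun j => a j * (Circle.exp (ξ j * δ) ^ m : Circle)) (F (m * δ)) := by
    refine (hF (m * δ)).congr_fun fun j => ?_
    rw [← Circle.exp_zsmul, Circle.coe_exp, zsmul_eq_mul]
    push_cast
    ring_nf
  have hvanish (m : ℤ) (hm : -(2 * K : ℕ) < m) (hm0 : m ≤ 0) : F (m * δ) = 0 := by
    have : -(2 * K : ℝ) < m := by exact_mod_cast hm
    have : (m : ℝ) ≤ 0 := by exact_mod_cast hm0
    exact h0 _ ⟨by nlinarith, by nlinarith⟩
  simpa only [Nat.cast_succ, Int.cast_add, Int.cast_natCast, Int.cast_one] using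
    sum_norm_div_le_of_vanishing ha hsample hvanish

theorem integrableOn_Ioc_div (hF : IsAbsConvExpSeries F) {b : ℝ} (hb : 0 < b)
    (h0 : ∀ s ∈ Set.Ioc (-(2 * b)) 0, F s = 0) :
    IntegrableOn (fun s : ℝ => F s / s) (Set.Ioc 0 b) := by
  have hcont := hF.continuous
  refine ⟨(hcont.measurable.div Complex.measurable_ofReal).aestronglyMeasurable, ?_⟩
  obtain ⟨ι, a, ξ, ha, hF⟩ := hF
  refine (lintegral_Ioc_le_of_riemann_sum_le hb
    (C := ENNReal.ofReal (32 * Real.exp 1 * ∑' j, ‖a j‖)) (fun s hs => ?_)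
    fun K hK => ?_).trans_lt ENNReal.ofReal_lt_top
  · exact (hcont.continuousAt.div Complex.continuous_ofReal.continuousAt
      (Complex.ofReal_ne_zero.2 hs.ne')).enorm
  · have hδ : 0 < b / K := by positivity
    have hterm (n : ℕ) : ENNReal.ofReal (b / K) *
        ‖F ((n + 1 : ℕ) * (b / K)) / ((n + 1 : ℕ) * (b / K) : ℝ)‖ₑ =
          ENNReal.ofReal (‖F ((n + 1 : ℕ) * (b / K))‖ / ((n : ℝ) + 1)) := by
      rw [← ofReal_norm, ← ENNReal.ofReal_mul hδ.le, norm_div, Complex.norm_real,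
        Real.norm_of_nonneg (by positivity), Nat.cast_succ]
      congr 1
      field_simp
    simp_rw [hterm]
    rw [← ENNReal.ofReal_sum_of_nonneg fun n _ => by positivity]
    refine ENNReal.ofReal_le_ofReal (sum_norm_sample_div_le ha hF hδ ?_)
    rwa [mul_div_cancel₀ b (by positivity)]

/- `F ± E` vanishes on one side of the origin, and `2 F` is the sum of the two. -/
theorem intervalIntegrable_div {E : ℝ → ℂ} (hF : IsAbsConvExpSeries F) (hE : IsAbsConvExpSeries E)
    {b : ℝ} (hb : 0 < b) (hpos : ∀ s ∈ Set.Ico 0 (2 * b), E s = F s)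
    (hneg : ∀ s ∈ Set.Ioc (-(2 * b)) 0, E s = -F s) :
    IntervalIntegrable (fun s : ℝ => F s / s) volume (-b) b := by
  have right : IntegrableOn (fun s : ℝ => F s / s) (Set.Ioc 0 b) := by
    have h := (hF.add hE).integrableOn_Ioc_div hb fun s hs => by rw [hneg s hs, add_neg_cancel]
    refine IntegrableOn.congr_fun (h.const_mul (1 / 2)) (fun s hs => ?_) measurableSet_Ioc
    simp only [hpos s ⟨hs.1.le, by linarith [hs.2]⟩]
    ring
  have left : IntegrableOn (fun s : ℝ => F (-s) / (-s : ℝ)) (Set.Ioc 0 b) := by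
    have h := (hF.comp_neg.add hE.comp_neg.neg).integrableOn_Ioc_div hb fun s hs => by
      rw [hpos (-s) ⟨by linarith [hs.2], by linarith [hs.1]⟩, add_neg_cancel]
    refine IntegrableOn.congr_fun (h.const_mul (-1 / 2)) (fun s hs => ?_) measurableSet_Ioc
    simp only [hneg (-s) ⟨by linarith [hs.2], by linarith [hs.1]⟩]
    push_cast
    ring
  rw [← intervalIntegrable_iff_integrableOn_Ioc_of_le hb.le] at left right
  refine IntervalIntegrable.trans (b := 0) ?_ right
  simpa using ((IntervalIntegrable.iff_comp_neg).1 left).symm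

end IsAbsConvExpSeries

end RiemannSum

section HalfFourier

open MeasureTheory AddCircle

variable {T : ℝ}

theorem isAbsConvExpSeries_of_hasSum_fourier {d : ℤ → ℂ} (hd : Summable fun k => ‖d k‖)
    {f : AddCircle T → ℂ} (hf : ∀ x, HasSum (fun k => d k • fourier k x) (f x)) :
    IsAbsConvExpSeries fun s => f s := by
  refine ⟨ℤ, d, fun k => 2 * Real.pi * k / T, hd, fun s => (hf s).congr_fun fun k => ?_⟩
  rw [fourier_coe_apply, smul_eq_mul]
  push_cast
  ring_nf

variable [hT : Fact (0 < T)]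

variable (T) in
/-- The function `t ↦ exp (-π i t / T)` on `[0, T)`: a discontinuous branch on the circle of the
character of frequency `-1/2`. Its Fourier coefficients are the kernel of the discrete Hilbert
transform up to the factor `(π i)⁻¹`. -/
noncomputable def halfFourier : AddCircle T → ℂ :=
  liftIco T 0 fun t => Complex.exp (-(Real.pi * t / T * Complex.I))

theorem halfFourier_of_mem_Ico {t : ℝ} (ht : t ∈ Set.Ico 0 T) :
    halfFourier T t = Complex.exp (-(Real.pi * t / T * Complex.I)) :=
  liftIco_zero_coe_apply ht

theorem exp_mul_halfFourier_of_nonneg {t : ℝ} (ht : t ∈ Set.Ico 0 T) :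
    Complex.exp ((Real.pi / T : ℝ) * t * Complex.I) * halfFourier T t = 1 := by
  rw [halfFourier_of_mem_Ico ht, ← Complex.exp_add, ← Complex.exp_zero]
  push_cast
  ring_nf

theorem exp_mul_halfFourier_of_neg {t : ℝ} (ht : t ∈ Set.Ico (-T) 0) :
    Complex.exp ((Real.pi / T : ℝ) * t * Complex.I) * halfFourier T t = -1 := by
  have hT0 : (T : ℂ) ≠ 0 := Complex.ofReal_ne_zero.2 hT.out.ne'
  rw [← coe_add_period, halfFourier_of_mem_Ico ⟨by linarith [ht.1], by linarith [ht.2]⟩,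
    ← Complex.exp_add, ← Complex.exp_neg_pi_mul_I]
  congr 1
  push_cast
  field_simp
  ring

theorem integrable_halfFourier : Integrable (halfFourier T) haarAddCircle := by
  have hm : Measurable (halfFourier T) :=
    Measurable.comp (g := fun t : Set.Ico 0 (0 + T) => Complex.exp (-(Real.pi * t / T * Complex.I)))
      (by fun_prop) (measurableEquivIco T 0).measurable
  refine .of_bound hm.aestronglyMeasurable 1 (.of_forall fun x => ?_)
  obtain ⟨t, ht, rfl⟩ := eq_coe_Ico x
  rw [halfFourier_of_mem_Ico ht, Complex.norm_exp]
  simp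

theorem fourierCoeff_halfFourier (n : ℤ) :
    fourierCoeff (halfFourier T) n = (Real.pi * Complex.I)⁻¹ * ((n : ℂ) + 1 / 2)⁻¹ := by
  have hT0 : (T : ℂ) ≠ 0 := Complex.ofReal_ne_zero.2 hT.out.ne'
  have hpi : (Real.pi : ℂ) ≠ 0 := Complex.ofReal_ne_zero.2 Real.pi_ne_zero
  have hI := Complex.I_ne_zero
  have hn : (2 * n + 1 : ℂ) ≠ 0 := by exact_mod_cast (by omega : 2 * n + 1 ≠ 0)
  set c : ℂ := -((2 * n + 1) * Real.pi * Complex.I / T) with hc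
  have exp_period : Complex.exp (c * T) = -1 := by
    rw [show c * T = (-n : ℤ) * (2 * Real.pi * Complex.I) - Real.pi * Complex.I by
      rw [hc]; push_cast; field_simp; ring, Complex.exp_sub_pi_mul_I,
      Complex.exp_int_mul_two_pi_mul_I]
  have integral_eq : ∫ t in (0 : ℝ)..T, fourier (-n) (t : AddCircle T) • halfFourier T t =
      ∫ t in (0 : ℝ)..T, Complex.exp (c * t) := by
    refine intervalIntegral.integral_congr_Ioo_of_le hT.out.le fun t ht => ?_
    rw [halfFourier_of_mem_Ico ⟨ht.1.le, ht.2⟩, fourier_coe_apply, smul_eq_mul, ← Complex.exp_add,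
      hc]
    congr 1
    push_cast
    ring
  rw [fourierCoeff_eq_intervalIntegral _ n 0, zero_add, integral_eq,
    integral_exp_mul_complex (by simp [hc, hT0, hpi, hn]), exp_period, Complex.ofReal_zero,
    mul_zero, Complex.exp_zero, Complex.real_smul, hc]
  push_cast
  field_simp
  norm_num

theorem continuous_halfFourier_mul {D : C(AddCircle T, ℂ)} (h0 : D 0 = 0) :
    Continuous fun x => halfFourier T x * D x := by
  have hlift : (fun x => halfFourier T x * D x) =
      liftIco T 0 fun t => Complex.exp (-(Real.pi * t / T * Complex.I)) * D t := by
    ext x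
    obtain ⟨t, ht, rfl⟩ := eq_coe_Ico x
    rw [halfFourier_of_mem_Ico ht, liftIco_zero_coe_apply ht]
  rw [hlift]
  refine liftIco_zero_continuous ?_ (Continuous.continuousOn ?_)
  · rw [coe_period, QuotientAddGroup.mk_zero, h0, mul_zero, mul_zero]
  · have : Continuous fun t : ℝ => D t := D.continuous.comp (AddCircle.continuous_mk' T)
    fun_prop

theorem fourierCoeff_halfFourier_mul {d h : ℤ → ℂ} {D : C(AddCircle T, ℂ)}
    (hD : HasSum (fun k => d k • fourier k) D) (hh : HasDiscreteHilbertTransform d h) (n : ℤ) :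
    fourierCoeff (fun x => halfFourier T x * D x) n = (Real.pi * Complex.I)⁻¹ * h n := by
  refine tendsto_nhds_unique ((hasSum_fourierCoeff_mul (m := id) integrable_halfFourier hD n).comp
    (Finset.tendsto_Icc_neg (R := ℤ))) (((hh n).const_mul _).congr fun N => ?_)
  rw [Function.comp_apply, Finset.mul_sum]
  refine Finset.sum_congr rfl fun k _ => ?_
  simp only [fourierCoeff_halfFourier, id]
  push_cast
  ring

theorem intervalIntegrable_div_of_summable {d h : ℤ → ℂ} (hd : Summable fun k => ‖d k‖)
    {D : C(AddCircle T, ℂ)} (hD : HasSum (fun k => d k • fourier k) D) (h0 : D 0 = 0)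
    (hh : HasDiscreteHilbertTransform d h) (hhs : Summable fun n => ‖h n‖) :
    IntervalIntegrable (fun t : ℝ => D t / t) volume (-(T / 2)) (T / 2) := by
  let twist : C(AddCircle T, ℂ) := ⟨fun x => halfFourier T x * D x, continuous_halfFourier_mul h0⟩
  have coeff_twist : fourierCoeff twist = fun n => (Real.pi * Complex.I)⁻¹ * h n :=
    funext (fourierCoeff_halfFourier_mul hD hh)
  have summable_coeff : Summable fun n => ‖fourierCoeff twist n‖ := by
    simpa only [coeff_twist, norm_mul] using hhs.mul_left _
  have twist_series : IsAbsConvExpSeries fun s => twist s :=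
    isAbsConvExpSeries_of_hasSum_fourier summable_coeff
      (has_pointwise_sum_fourier_series_of_summable summable_coeff.of_norm)
  have D_series : IsAbsConvExpSeries fun s => D s :=
    isAbsConvExpSeries_of_hasSum_fourier hd fun x => hD.mapL (ContinuousMap.evalCLM ℂ x)
  refine D_series.intervalIntegrable_div (twist_series.exp_mul (Real.pi / T)) (half_pos hT.out)
    (fun s hs => ?_) fun s hs => ?_
  · rw [mul_div_cancel₀ _ two_ne_zero] at hs
    exact (mul_assoc _ _ _).symm.trans (by rw [exp_mul_halfFourier_of_nonneg hs, one_mul])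
  · rw [mul_div_cancel₀ _ two_ne_zero] at hs
    obtain rfl | hs0 := hs.2.eq_or_lt
    · simp [twist, h0]
    · exact (mul_assoc _ _ _).symm.trans
        (by rw [exp_mul_halfFourier_of_neg ⟨hs.1.le, hs0⟩, neg_one_mul])

end HalfFourier

section DivFourierSubOne

open MeasureTheory AddCircle

variable {T : ℝ}

theorem eq_zero_of_fourier_neg_one_eq_one (hT : T ≠ 0) {x : AddCircle T}
    (hx : fourier (-1) x = 1) : x = 0 := by
  rw [fourier_apply, neg_one_zsmul] at hx
  refine neg_eq_zero.1 (injective_toCircle hT (Circle.ext ?_))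
  rw [hx, toCircle_zero, Circle.coe_one]

variable [hT : Fact (0 < T)]

theorem mul_abs_le_norm_fourier_neg_one_sub_one {t : ℝ} (ht : |t| ≤ T / 2) :
    4 / T * |t| ≤ ‖fourier (-1) (t : AddCircle T) - 1‖ := by
  have hpi := Real.pi_pos
  have hT' := hT.out
  have half_angle : |-(Real.pi * t / T)| = Real.pi * |t| / T := by
    rw [abs_neg, abs_div, abs_mul, abs_of_pos hpi, abs_of_pos hT']
  have sin_ge := Real.mul_abs_le_abs_sin (x := -(Real.pi * t / T)) (by
    rw [half_angle, div_le_div_iff₀ hT' two_pos]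
    nlinarith)
  rw [half_angle] at sin_ge
  rw [fourier_coe_apply, show 2 * Real.pi * Complex.I * (-1 : ℤ) * t / T =
    Complex.I * (2 * -(Real.pi * t / T) : ℝ) by push_cast; ring,
    Complex.norm_exp_I_mul_ofReal_sub_one, norm_mul, Real.norm_two, Real.norm_eq_abs,
    mul_div_cancel_left₀ _ two_ne_zero]
  refine Eq.trans_le ?_ (mul_le_mul_of_nonneg_left sin_ge two_pos.le)
  field_simp
  ring

theorem integrable_div_fourier_sub_one {D : AddCircle T → ℂ} (hm : Measurable D)
    (hD : IntervalIntegrable (fun t : ℝ => D t / t) volume (-(T / 2)) (T / 2)) :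
    Integrable (fun x => D x / (fourier (-1) x - 1)) haarAddCircle := by
  have hT' := hT.out
  have hmf : Measurable fun x : AddCircle T => D x / (fourier (-1) x - 1) :=
    hm.div ((fourier (-1)).continuous.measurable.sub_const 1)
  rw [← memLp_one_iff_integrable, memLp_haarAddCircle_iff, memLp_one_iff_integrable,
    ← (AddCircle.measurePreserving_mk T (-(T / 2))).integrable_comp hmf.aestronglyMeasurable,
    show -(T / 2) + T = T / 2 by ring]
  rw [intervalIntegrable_iff_integrableOn_Ioc_of_le (by linarith)] at hD
  refine (hD.norm.const_mul (T / 4)).mono'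
    (hmf.comp AddCircle.measurable_mk').aestronglyMeasurable ?_
  refine (ae_restrict_iff' measurableSet_Ioc).2 (.of_forall fun t ht => ?_)
  rw [Function.comp_apply, norm_div, norm_div, Complex.norm_real, Real.norm_eq_abs]
  obtain rfl | ht0 := eq_or_ne t 0
  · simp
  have : 0 < |t| := abs_pos.2 ht0
  calc ‖D t‖ / ‖fourier (-1) (t : AddCircle T) - 1‖
      ≤ ‖D t‖ / (4 / T * |t|) := by
        gcongr
        exact mul_abs_le_norm_fourier_neg_one_sub_one (abs_le.2 ⟨ht.1.le, ht.2⟩)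
    _ = T / 4 * (‖D t‖ / |t|) := by field_simp

theorem isNullSeq_fourierCoeff (f : AddCircle T → ℂ) : IsNullSeq (fourierCoeff f) := by
  have riemann_lebesgue := ((Real.tendsto_integral_exp_smul_cocompact
    ((Set.Ioc 0 T).indicator fun x : ℝ => f x)).comp
      (Int.tendsto_zmultiplesHom_cofinite (inv_ne_zero hT.out.ne'))).const_smul (1 / T)
  rw [smul_zero] at riemann_lebesgue
  refine riemann_lebesgue.congr fun n => ?_
  rw [fourierCoeff_eq_intervalIntegral f n 0, zero_add, intervalIntegral.integral_of_le hT.out.le,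
    ← integral_indicator measurableSet_Ioc, Function.comp_apply]
  congr 2 with x
  by_cases hx : x ∈ Set.Ioc 0 T
  · have := hT.out.ne'
    rw [Set.indicator_of_mem hx, Set.indicator_of_mem hx, fourier_coe_apply, Circle.smul_def,
      Real.fourierChar_apply, zmultiplesHom_apply, zsmul_eq_mul]
    congr 2
    push_cast
    field_simp
  · rw [Set.indicator_of_notMem hx, Set.indicator_of_notMem hx, smul_zero]

end DivFourierSubOne

theorem IsNullSeq.tendsto_sum_Icc_sub {u : ℤ → ℂ} (hu : IsNullSeq u) :
    Tendsto (fun N : ℕ => ∑ k ∈ Finset.Icc (-(N : ℤ)) N, (u (k + 1) - u k)) atTop (𝓝 0) := by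
  have telescope (N : ℕ) :
      ∑ k ∈ Finset.Icc (-(N : ℤ)) N, (u (k + 1) - u k) = u (N + 1) - u (-N) := by
    have sum_Ico := congrArg Neg.neg (Finset.sum_Ico_int_sub N u)
    simp only [← Finset.sum_neg_distrib, neg_sub] at sum_Ico
    rw [← Finset.Ico_insert_right (by omega), Finset.sum_insert (by simp), sum_Ico,
      sub_add_sub_cancel]
  have tendsto_comp {g : ℕ → ℤ} (hg : g.Injective) : Tendsto (u ∘ g) atTop (𝓝 0) :=
    Nat.cofinite_eq_atTop ▸ hu.comp hg.tendsto_cofinite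
  simp only [telescope]
  rw [← sub_zero (0 : ℂ)]
  exact (tendsto_comp (g := fun N => N + 1) fun a b h => by simpa using h).sub
    (tendsto_comp (g := fun N => -N) fun a b h => by simpa using h)

theorem IsNullSeq.hasSum_sub_zero {c : ℤ → ℂ} (hc : IsNullSeq c)
    (hd : Summable fun k => c (k + 1) - c k) : HasSum (fun k => c (k + 1) - c k) 0 :=
  tendsto_nhds_unique (hd.hasSum.comp (Finset.tendsto_Icc_neg (R := ℤ))) hc.tendsto_sum_Icc_sub ▸
    hd.hasSum

theorem IsNullSeq.eq_of_sub_eq {a c : ℤ → ℂ} (ha : IsNullSeq a) (hc : IsNullSeq c)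
    (h : ∀ k, a (k + 1) - a k = c (k + 1) - c k) : a = c := by
  have const (k : ℤ) : a k - c k = a 0 - c 0 := by
    induction k using Int.induction_on with
    | zero => rfl
    | succ i ih => linear_combination ih + h i
    | pred i ih =>
      have := h (-i - 1)
      rw [sub_add_cancel] at this
      linear_combination ih - this
  have const_zero : a 0 - c 0 = 0 :=
    tendsto_nhds_unique (tendsto_const_nhds.congr fun k => (const k).symm)
      (sub_zero (0 : ℂ) ▸ ha.sub hc)
  exact funext fun k => sub_eq_zero.1 ((const k).trans const_zero)

theorem half_le_norm_half_integer (m : ℤ) : (1 / 2 : ℝ) ≤ ‖(m : ℂ) + 1 / 2‖ := by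
  have : (1 : ℝ) ≤ |(2 * m + 1 : ℤ)| := by exact_mod_cast Int.one_le_abs (by omega)
  rw [show (m : ℂ) + 1 / 2 = ((2 * m + 1 : ℤ) : ℂ) / 2 by push_cast; ring, norm_div,
    Complex.norm_intCast, Complex.norm_two]
  gcongr
  exact_mod_cast this

theorem IsNullSeq.div_half_integer {c : ℤ → ℂ} (hc : IsNullSeq c) (n : ℤ) :
    IsNullSeq fun k => c k / ((n : ℂ) + 1 / 2 - k) := by
  refine squeeze_zero_norm (a := fun k => 2 * ‖c k‖) (fun k => ?_)
    (by simpa using hc.norm.const_mul 2)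
  have := half_le_norm_half_integer (n - k)
  rw [Int.cast_sub, sub_add_eq_add_sub] at this
  rw [norm_div, div_le_iff₀ (by linarith)]
  nlinarith [norm_nonneg (c k)]

theorem HasDiscreteHilbertTransform.sub_shift {c h : ℤ → ℂ} (hc : IsNullSeq c)
    (hh : HasDiscreteHilbertTransform c h) :
    HasDiscreteHilbertTransform (fun k => c (k + 1) - c k) fun n => h (n + 1) - h n := by
  intro n
  have telescoping := (hc.div_half_integer (n + 1)).tendsto_sum_Icc_sub
  have limit := (telescoping.add (hh (n + 1))).sub (hh n)
  rw [zero_add] at limit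
  refine limit.congr fun N => ?_
  rw [← Finset.sum_add_distrib, ← Finset.sum_sub_distrib]
  refine Finset.sum_congr rfl fun k _ => ?_
  push_cast
  rw [add_right_comm, add_sub_add_right_eq_sub]
  ring

section FourierSeries

open MeasureTheory AddCircle

variable {T : ℝ} [hT : Fact (0 < T)]

theorem fourierCoeff_of_hasSum {d : ℤ → ℂ} {D : C(AddCircle T, ℂ)}
    (hD : HasSum (fun k => d k • fourier k) D) (n : ℤ) : fourierCoeff D n = d n := by
  have coeff_sum := hD.mapL (fourierCoeffCLM n)
  simp only [map_smul, fourierCoeffCLM_apply, fourierCoeff_fourier, smul_eq_mul] at coeff_sum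
  refine coeff_sum.unique ?_
  convert hasSum_single (f := fun k => d k * (Pi.single k (1 : ℂ) : ℤ → ℂ) n) n fun k hk => ?_
  · rw [Pi.single_eq_same, mul_one]
  · rw [Pi.single_eq_of_ne hk.symm, mul_zero]

theorem IsNullSeq.fourierCoeff_div_fourier_sub_one {c : ℤ → ℂ} (hc : IsNullSeq c)
    {D : C(AddCircle T, ℂ)} (h0 : D 0 = 0)
    (hf : Integrable (fun x => D x / (fourier (-1) x - 1)) haarAddCircle)
    (hD : HasSum (fun k => (c (k + 1) - c k) • fourier k) D) :
    fourierCoeff (fun x => D x / (fourier (-1) x - 1)) = c := by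
  set f : AddCircle T → ℂ := fun x => D x / (fourier (-1) x - 1)
  have f_mul_fourier : (fun x => f x * fourier (-1) x) = f + ⇑D := by
    ext x
    rw [Pi.add_apply, ← sub_eq_iff_eq_add', ← mul_sub_one]
    refine div_mul_cancel_of_imp fun hx => ?_
    rw [eq_zero_of_fourier_neg_one_eq_one hT.out.ne' (sub_eq_zero.1 hx), h0]
  refine (isNullSeq_fourierCoeff f).eq_of_sub_eq hc fun k => ?_
  rw [← fourierCoeff_of_hasSum hD k, sub_eq_iff_eq_add', ← sub_neg_eq_add,
    ← fourierCoeff_mul_fourier, f_mul_fourier,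
    fourierCoeff.add hf (integrable_haarAddCircle_of_continuous D.continuous), Pi.add_apply]

end FourierSeries

theorem IsNullSeq.isFourierSeries_of_summable {c h : ℤ → ℂ} (hc : IsNullSeq c) (hbv : IsBV c)
    (hh : HasDiscreteHilbertTransform (fun k => c (k + 1) - c k) h)
    (hhs : Summable fun n => ‖h n‖) : IsFourierSeries c := by
  have : Fact (0 < 2 * Real.pi) := ⟨Real.two_pi_pos⟩
  have hd : Summable fun k : ℤ => ‖c (k + 1) - c k‖ := hbv.congr fun k => norm_sub_rev _ _
  obtain ⟨D, hD⟩ : Summable fun k : ℤ =>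
      (c (k + 1) - c k) • (fourier k : C(AddCircle (2 * Real.pi), ℂ)) := by
    refine .of_norm ?_
    simpa only [norm_smul, fourier_norm, mul_one] using hd
  have h0 : D 0 = 0 := by
    refine (hD.mapL (ContinuousMap.evalCLM ℂ 0)).unique ?_
    simpa [fourier_eval_zero, -fourier_apply] using hc.hasSum_sub_zero hd.of_norm
  have integrable_f := integrable_div_fourier_sub_one D.continuous.measurable
    (intervalIntegrable_div_of_summable hd hD h0 hh hhs)
  exact ⟨_, integrable_f, congrFun (hc.fourierCoeff_div_fourier_sub_one h0 integrable_f hD)⟩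

theorem mainTheorem4 (c : ℤ → ℂ) (hnull : IsNullSeq c) (hbv : IsBV c) :
    ((∃ h : ℤ → ℂ, HasDiscreteHilbertTransform (fun k => c (k + 1) - c k) h ∧
        Summable fun n : ℤ => ‖h n‖) → IsFourierSeries c) ∧
    ((∃ h : ℤ → ℂ, HasDiscreteHilbertTransform c h ∧ IsBV h) → IsFourierSeries c) := by
  refine ⟨fun ⟨h, hh, hhs⟩ => hnull.isFourierSeries_of_summable hbv hh hhs, fun ⟨h, hh, hhbv⟩ => ?_⟩
  exact hnull.isFourierSeries_of_summable hbv (hh.sub_shift hnull)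
    (hhbv.congr fun n => norm_sub_rev _ _)
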